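/- Let $M,s>0$, let $\log$ denote the logarithm to base $2$ and $\ln$ the natural logarithm. Let $\mathcal{A}_s(M)$ be the class of $2\pi$-periodic functions $f\colon\mathbb{R}\to\mathbb{C}$ that can be analytically continued to the open strip $\mathcal{S}=\{z\in\mathbb{C} : |\operatorname{Im} z|<s\}$ such that the continuation satisfies $\sup_{z\in\mathcal{S}}|f(z)|\le M$. Let $\mathcal{X}\supseteq\mathcal{A}_s(M)$ be any set of bounded $2\pi$-periodic functions $\mathbb{R}\to\mathbb{C}$, equipped with the metric $d_{2\pi}(f_1,f_2)=\sup_{x\in[0,2\pi]}|f_1(x)-f_2(x)|$. For $\varepsilon>0$ let $N(\varepsilon)$ be the smallest number of elements $f_1,\dots,f_N\in\mathcal{X}$ such that every $f\in\mathcal{A}_s(M)$ satisfies $d_{2\pi}(f,f_i)\le\varepsilon$ for some $i$, and let $H(\varepsilon;\mathcal{A}_s(M),d_{2\pi})=\log N(\varepsilon)$ be the metric entropy. Then $N(\varepsilon)$ is finite for every $\varepsilon>0$, and there is a function $\gamma\colon(0,\infty)\to\mathbb{R}$ with $|\gamma(\varepsilon)|\le 1$ for all $\varepsilon>0$ such that,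 as $\varepsilon\to0^+$, $$H(\varepsilon;\mathcal{A}_s(M),d_{2\pi})=\frac{2\ln 2}{s}\Big[\log^2(\varepsilon^{-1})+\log(\varepsilon^{-1})\,\log\log(\varepsilon^{-1})\,\big(\gamma(\varepsilon)+o(1)\big)\Big].$$ -/

import Mathlib

open Set Filter Topology

noncomputable section

/-- Metric entropy of a subset `K` of a metric space `X`: the base 2 logarithm of the smallest
number of closed `ε`-balls, with centres anywhere in `X`, that cover `K`. -/
def metricEntropy {X : Type*} [PseudoMetricSpace X] (K : Set X) (ε : ℝ) : ℝ :=
  Real.logb 2 ((Metric.externalCoveringNumber ε.toNNReal K).toNat : ℝ)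

/-- Bounded `2π`-periodic functions `ℝ → ℂ`; the metric on them is `periodicDist`. -/
structure PeriodicFun where
  toFun : ℝ → ℂ
  periodic' : Function.Periodic toFun (2 * Real.pi)
  bounded' : ∃ C : ℝ, ∀ x : ℝ, ‖toFun x‖ ≤ C

instance : CoeFun PeriodicFun (fun _ => ℝ → ℂ) := ⟨PeriodicFun.toFun⟩

/-- The supremum over `x ∈ [0, 2π]` of `|f₁ x - f₂ x|`. -/
def periodicDist (f g : PeriodicFun) : ℝ :=
  ⨆ x : Icc (0 : ℝ) (2 * Real.pi), ‖f x - g x‖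

theorem periodicDist_bddAbove (f g : PeriodicFun) :
    BddAbove (range fun x : Icc (0 : ℝ) (2 * Real.pi) => ‖f x - g x‖) := by
  obtain ⟨C, hC⟩ := f.bounded'
  obtain ⟨D, hD⟩ := g.bounded'
  refine ⟨C + D, ?_⟩
  rintro _ ⟨x, rfl⟩
  exact (norm_sub_le _ _).trans (add_le_add (hC x) (hD x))

instance : Nonempty (Icc (0 : ℝ) (2 * Real.pi)) := ⟨⟨0, le_rfl, by positivity⟩⟩

theorem norm_sub_le_periodicDist (f g : PeriodicFun) (x : ℝ) :
    ‖f x - g x‖ ≤ periodicDist f g := by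
  obtain ⟨y, hy, hxy⟩ := (f.periodic'.sub g.periodic').exists_mem_Ico₀ Real.two_pi_pos x
  have h : f x - g x = f y - g y := by simpa using hxy
  rw [h]
  exact le_ciSup (periodicDist_bddAbove f g) ⟨y, hy.1, hy.2.le⟩

instance : MetricSpace PeriodicFun where
  dist := periodicDist
  dist_self f := by simp [periodicDist]
  dist_comm f g := by simp [periodicDist, norm_sub_rev]
  dist_triangle f g h := by
    refine ciSup_le fun x => ?_
    calc ‖f x - h x‖ ≤ ‖f x - g x‖ + ‖g x - h x‖ := norm_sub_le_norm_sub_add_norm_sub _ _ _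
      _ ≤ _ := add_le_add (norm_sub_le_periodicDist f g x) (norm_sub_le_periodicDist g h x)
  eq_of_dist_eq_zero := by
    intro f g h
    have h0 : f.toFun = g.toFun := by
      funext x
      have h1 := norm_sub_le_periodicDist f g x
      rw [show periodicDist f g = 0 from h] at h1
      exact sub_eq_zero.1 (norm_le_zero_iff.1 h1)
    cases f; cases g; cases h0; rfl

/-- The open strip `{z : |Im z| < s}`. -/
def openStrip (s : ℝ) : Set ℂ := {z | |z.im| < s}

/-- The `2π`-periodic functions on `ℝ` with an analytic continuation to the open strip
`|Im z| < s` that is bounded by `M` there. -/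
def analyticStripClass (s M : ℝ) : Set PeriodicFun :=
  {f | ∃ F : ℂ → ℂ, AnalyticOnNhd ℂ F (openStrip s) ∧ (∀ x : ℝ, F x = f x) ∧
    ∀ z ∈ openStrip s, ‖F z‖ ≤ M}

end

/-! The class is compared with boxes of Fourier coefficients, and covering numbers are estimated by
volumes. Write ℓ = ln(1/ε), n = ℓ/s + O(1) and m = 2n + 1. Shifting contours gives |c_k| ≤ M
e^{-s|k|}, so truncation at degree n costs O(ε). Values at m equispaced nodes are the discrete
Fourier transform of the coefficients; this map multiplies real volume by m^m.

Upper bound (`externalCoveringNumber_le`): sampled coefficient vectors lie in the transform of a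
box, where a volume comparison limits separated sets. Sampling loses only the Lebesgue constant 4 +
ln m (`norm_trigPoly_le`), which adds O(m ln ln m) to ln N.

Lower bound (`le_externalCoveringNumber`): the box shrunk by the factor m consists of coefficients
of class members. Sampling does not increase distances, so an ε-cover yields sup-norm balls covering
the transformed box. Shrinking costs m^{-2m} in volume, leaving m^{-m}.

Hence ln N = 2mℓ - 2s n(n+1) ± m ln m, up to lower order. The first two terms give (2/s)ℓ² + O(1),
while m ln m ~ (2/s)ℓ ln ℓ with either sign: this is the bound |γ| ≤ 1. -/

/-! ### Analytic periodic functions on a strip and decay of Fourier coefficients. -/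

theorem convex_openStrip (s : ℝ) : Convex ℝ (openStrip s) := by
  have h : openStrip s = Complex.imLm ⁻¹' Ioo (-s) s := by
    ext z; simp [openStrip, abs_lt]
  rw [h]
  exact (convex_Ioo _ _).linear_preimage _

theorem add_real_mem_openStrip {s : ℝ} {z : ℂ} (hz : z ∈ openStrip s) (t : ℝ) :
    z + t ∈ openStrip s := by
  simpa [openStrip] using hz

theorem ofReal_mem_openStrip {s : ℝ} (hs : 0 < s) (x : ℝ) : (x : ℂ) ∈ openStrip s := by
  simpa [openStrip] using hs

/-- An analytic function on a strip which is `T`-periodic on the real line is `T`-periodic on the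
strip. -/
theorem periodic_of_periodic_real {s T : ℝ} (hs : 0 < s) {F : ℂ → ℂ}
    (hF : AnalyticOnNhd ℂ F (openStrip s)) (hT : ∀ x : ℝ, F (x + T) = F x) {z : ℂ}
    (hz : z ∈ openStrip s) : F (z + T) = F z := by
  have hG : AnalyticOnNhd ℂ (fun z => F (z + T)) (openStrip s) := fun w hw =>
    (hF (w + T) (add_real_mem_openStrip hw T)).comp_of_eq
      (analyticAt_id.add analyticAt_const : AnalyticAt ℂ (fun z => z + (T : ℂ)) w) rfl
  refine hG.eqOn_of_preconnected_of_frequently_eq hF (convex_openStrip s).isPreconnected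
    (by simpa using ofReal_mem_openStrip hs 0 : (0 : ℂ) ∈ openStrip s) ?_ hz
  have ht : Tendsto (fun x : ℝ => (x : ℂ)) (𝓝[≠] 0) (𝓝[≠] 0) := by
    refine tendsto_nhdsWithin_iff.2 ⟨?_, ?_⟩
    · have : Tendsto (fun x : ℝ => (x : ℂ)) (𝓝 0) (𝓝 ((0 : ℝ) : ℂ)) :=
        Complex.continuous_ofReal.tendsto 0
      exact (by simpa using this : Tendsto (fun x : ℝ => (x : ℂ)) (𝓝 0) (𝓝 0)).mono_left
        nhdsWithin_le_nhds
    · filter_upwards [self_mem_nhdsWithin] with x hx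
      simpa using hx
  exact ht.frequently (Eventually.of_forall fun x => hT x).frequently

/-- The integral over a period of a periodic analytic function does not change when the path is
shifted parallel to the real line. -/
theorem integral_shift_eq {s T y : ℝ} {G : ℂ → ℂ}
    (hG : AnalyticOnNhd ℂ G (openStrip s)) (hT : ∀ z ∈ openStrip s, G (z + T) = G z)
    (hy : |y| < s) :
    ∫ x in (0 : ℝ)..T, G x = ∫ x in (0 : ℝ)..T, G (x + y * Complex.I) := by
  have hsub : (uIcc (0 : ℂ).re (T + y * Complex.I : ℂ).re) ×ℂ
      (uIcc (0 : ℂ).im (T + y * Complex.I : ℂ).im) ⊆ openStrip s := by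
    intro z hz
    have h2 : z.im ∈ uIcc 0 y := by simpa using hz.2
    have := abs_sub_left_of_mem_uIcc h2
    simp only [sub_zero] at this
    exact this.trans_lt hy
  have h := Complex.integral_boundary_rect_eq_zero_of_differentiableOn G 0 (T + y * Complex.I)
    (hG.differentiableOn.mono hsub)
  -- By periodicity the two vertical sides of the rectangle cancel.
  have hv : ∫ t in (0 : ℝ)..y, G (T + t * Complex.I) = ∫ t in (0 : ℝ)..y, G (t * Complex.I) := by
    refine intervalIntegral.integral_congr fun t ht => ?_
    have hz : (t * Complex.I : ℂ) ∈ openStrip s := by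
      have := abs_sub_left_of_mem_uIcc ht
      simp only [sub_zero] at this
      simpa [openStrip] using this.trans_lt hy
    simpa [add_comm] using hT _ hz
  simp at h
  rw [hv] at h
  linear_combination h

theorem exp_mul_int_periodic (k : ℤ) (z : ℂ) :
    Complex.exp (-(Complex.I * k * (z + (2 * Real.pi : ℝ)))) = Complex.exp (-(Complex.I * k * z)) := by
  have := Complex.exp_periodic.int_mul (-k) (-(Complex.I * k * z))
  rw [← this]
  congr 1
  push_cast
  ring

/-- Shift the path to height ±t, with the sign for which the exponential has modulus e^{-t|k|}. The
bound on F is known only in the open strip, so t < s at first, and then t → s. -/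
theorem norm_integral_exp_mul_le {s M : ℝ} (hs : 0 < s) {F : ℂ → ℂ}
    (hF : AnalyticOnNhd ℂ F (openStrip s))
    (hT : ∀ z ∈ openStrip s, F (z + (2 * Real.pi : ℝ)) = F z)
    (hM : ∀ z ∈ openStrip s, ‖F z‖ ≤ M) (k : ℤ) :
    ‖∫ x in (0 : ℝ)..2 * Real.pi, Complex.exp (-(Complex.I * k * x)) * F x‖ ≤
      2 * Real.pi * (M * Real.exp (-s * |(k : ℝ)|)) := by
  have hG : AnalyticOnNhd ℂ (fun z => Complex.exp (-(Complex.I * k * z)) * F z) (openStrip s) := by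
    intro z hz
    exact AnalyticAt.mul (by fun_prop) (hF z hz)
  have key : ∀ t ∈ Ioo 0 s,
      ‖∫ x in (0 : ℝ)..2 * Real.pi, Complex.exp (-(Complex.I * k * x)) * F x‖ ≤
      2 * Real.pi * (M * Real.exp (-t * |(k : ℝ)|)) := by
    intro t ht
    obtain ⟨y, hy, hyk⟩ : ∃ y : ℝ, |y| = t ∧ k * y = -t * |(k : ℝ)| := by
      rcases le_total (0 : ℝ) k with h | h
      · exact ⟨-t, by simp [abs_of_pos ht.1], by rw [abs_of_nonneg h]; ring⟩
      · exact ⟨t, by simp [abs_of_pos ht.1], by rw [abs_of_nonpos h]; ring⟩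
    have hy' : |y| < s := hy ▸ ht.2
    rw [integral_shift_eq hG (fun z hz => by rw [hT z hz, exp_mul_int_periodic]) hy']
    have hb : ∀ x : ℝ, ‖Complex.exp (-(Complex.I * k * (x + y * Complex.I))) *
        F (x + y * Complex.I)‖ ≤ M * Real.exp (-t * |(k : ℝ)|) := by
      intro x
      rw [norm_mul, Complex.norm_exp, mul_comm]
      have : (-(Complex.I * k * (x + y * Complex.I))).re = -t * |(k : ℝ)| := by
        rw [← hyk]; simp
      rw [this]
      gcongr
      exact hM _ (by simpa [openStrip] using hy')
    have := intervalIntegral.norm_integral_le_of_norm_le_const (a := (0 : ℝ)) (b := 2 * Real.pi)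
      (fun x _ => hb x)
    refine this.trans_eq ?_
    rw [sub_zero, abs_of_pos Real.two_pi_pos, mul_comm]
  have hlim : Tendsto (fun t : ℝ => 2 * Real.pi * (M * Real.exp (-t * |(k : ℝ)|))) (𝓝[<] s)
      (𝓝 (2 * Real.pi * (M * Real.exp (-s * |(k : ℝ)|)))) := by
    refine Tendsto.mono_left (Continuous.tendsto ?_ s) nhdsWithin_le_nhds
    fun_prop
  exact ge_of_tendsto hlim (mem_of_superset (Ioo_mem_nhdsLT hs) key)

theorem summable_exp_neg_mul_abs {s : ℝ} (hs : 0 < s) :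
    Summable fun k : ℤ => Real.exp (-s * |(k : ℝ)|) := by
  have hgeo : Summable fun k : ℕ => Real.exp (-s * k) := by
    have := summable_geometric_of_lt_one (Real.exp_pos (-s)).le (by simpa using hs)
    refine this.congr fun k => ?_
    rw [← Real.exp_nat_mul, mul_comm]
  exact Summable.of_nat_of_neg (by simpa using hgeo) (by simpa using hgeo)

/-- Functions in `analyticStripClass s M` are sums of their Fourier series, whose coefficients
decay exponentially. -/
theorem exists_fourier_expansion {s M : ℝ} (hs : 0 < s) {f : PeriodicFun}
    (hf : f ∈ analyticStripClass s M) :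
    ∃ c : ℤ → ℂ, (∀ k, ‖c k‖ ≤ M * Real.exp (-s * |(k : ℝ)|)) ∧
      ∀ x : ℝ, HasSum (fun k => c k * Complex.exp (Complex.I * k * x)) (f x) := by
  obtain ⟨F, hF, hFf, hM⟩ := hf
  have hT : ∀ z ∈ openStrip s, F (z + (2 * Real.pi : ℝ)) = F z := by
    refine fun z hz => periodic_of_periodic_real hs hF (fun x => ?_) hz
    have := f.periodic' x
    rw [← Complex.ofReal_add, hFf, hFf]
    exact this
  have : Fact (0 < 2 * Real.pi) := ⟨Real.two_pi_pos⟩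
  have hcont : Continuous f.toFun := by
    have : f.toFun = fun x : ℝ => F x := funext fun x => (hFf x).symm
    rw [this]
    exact hF.continuousOn.comp_continuous Complex.continuous_ofReal (ofReal_mem_openStrip hs)
  -- Summable coefficients make the Fourier series of a continuous function on the circle converge
  -- to it at every point.
  let g : C(AddCircle (2 * Real.pi), ℂ) :=
    ⟨f.periodic'.lift, continuous_coinduced_dom.2 hcont⟩
  have hg : ∀ x : ℝ, g (x : AddCircle (2 * Real.pi)) = f x := fun x => f.periodic'.lift_coe x
  have hcoef : ∀ k, ‖fourierCoeff g k‖ ≤ M * Real.exp (-s * |(k : ℝ)|) := by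
    intro k
    rw [fourierCoeff_eq_intervalIntegral g k 0]
    have h1 : ∫ x in (0 : ℝ)..0 + 2 * Real.pi, (fourier (-k)) (x : AddCircle (2 * Real.pi)) • g x =
        ∫ x in (0 : ℝ)..2 * Real.pi, Complex.exp (-(Complex.I * k * x)) * F x := by
      rw [zero_add]
      refine intervalIntegral.integral_congr fun x _ => ?_
      simp only [hg, fourier_coe_apply, smul_eq_mul, hFf]
      congr 2
      push_cast
      have : (Real.pi : ℂ) ≠ 0 := by exact_mod_cast Real.pi_ne_zero
      field_simp
    rw [h1, norm_smul]
    have h2 := norm_integral_exp_mul_le hs hF hT hM k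
    rw [Real.norm_of_nonneg (by positivity)]
    rw [one_div, inv_mul_le_iff₀ Real.two_pi_pos]
    exact h2
  have hsum : Summable (fourierCoeff g) :=
    Summable.of_norm_bounded ((summable_exp_neg_mul_abs hs).mul_left M) hcoef
  refine ⟨fourierCoeff g, hcoef, fun x => ?_⟩
  have := has_pointwise_sum_fourier_series_of_summable hsum x
  rw [hg] at this
  convert! this using 2 with k
  rw [fourier_coe_apply, smul_eq_mul]
  congr 2
  push_cast
  have : (Real.pi : ℂ) ≠ 0 := by exact_mod_cast Real.pi_ne_zero
  field_simp

/-! ### The discrete Fourier transform as sampling of trigonometric polynomials. -/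

open scoped ZMod
open MeasureTheory

/-- The discrete Fourier transform on `ZMod m` multiplies volumes by `m ^ m`. -/
theorem volume_image_dft (m : ℕ) [NeZero m] (S : Set (ZMod m → ℂ)) :
    volume ((fun v => 𝓕 v : (ZMod m → ℂ) → (ZMod m → ℂ)) '' S) = (m : ENNReal) ^ m * volume S := by
  let A : (ZMod m → ℂ) →ₗ[ℝ] (ZMod m → ℂ) := (ZMod.dft (N := m) (E := ℂ)).toLinearMap.restrictScalars ℝ
  let R : (ZMod m → ℂ) →ₗ[ℝ] (ZMod m → ℂ) := LinearMap.funLeft ℝ ℂ (fun j : ZMod m => -j)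
  have hR : R ∘ₗ R = LinearMap.id := by
    ext1 j; ext; simp [R, LinearMap.funLeft]
  -- Fourier inversion: the square is m times a reflection. In real dimension 2m this gives (det A)²
  -- = m^{2m} up to sign.
  have hA : A ∘ₗ A = (m : ℝ) • R := by
    apply LinearMap.ext
    intro v
    have := ZMod.dft_dft v
    simpa [A, R, LinearMap.funLeft, Function.comp_def, Pi.smul_def] using! this
  have hRd : |LinearMap.det R| = 1 := by
    have := congrArg LinearMap.det hR
    rw [LinearMap.det_comp, LinearMap.det_id] at this
    rw [← abs_one, ← abs_eq_abs.2 (Or.inl this), abs_mul]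
    have h2 : |LinearMap.det R| * |LinearMap.det R| = 1 := by rw [← abs_mul, this, abs_one]
    nlinarith [abs_nonneg (LinearMap.det R)]
  have hdim : Module.finrank ℝ (ZMod m → ℂ) = m * 2 := by
    rw [Module.finrank_pi_fintype]; simp
  have hAd : |LinearMap.det A| = (m : ℝ) ^ m := by
    have := congrArg (fun B => |LinearMap.det B|) hA
    simp only [LinearMap.det_comp, LinearMap.det_smul, abs_mul, hRd, hdim, mul_one, pow_mul] at this
    rw [← sq, abs_of_nonneg (a := ((m : ℝ) ^ m) ^ 2) (by positivity)] at this
    exact (pow_left_inj₀ (abs_nonneg _) (by positivity) two_ne_zero).1 this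
  have := Measure.addHaar_image_linearMap volume A S
  rw [hAd] at this
  rw [show ((fun v => 𝓕 v : (ZMod m → ℂ) → (ZMod m → ℂ)) '' S) = A '' S from rfl, this]
  congr 1
  rw [ENNReal.ofReal_pow (by positivity), ENNReal.ofReal_natCast]

/-- The trigonometric polynomial of degree `n` with coefficients `c`. -/
noncomputable def trigPoly (n : ℕ) (c : ZMod (2 * n + 1) → ℂ) (x : ℝ) : ℂ :=
  ∑ k, c k * Complex.exp (Complex.I * k.valMinAbs * x)

/-- Reindexing of sums over `ZMod (2 * n + 1)` by the integers `-n, …, n`. -/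
theorem sum_valMinAbs {E : Type*} [AddCommMonoid E] (n : ℕ) (g : ℤ → E) :
    ∑ k : ZMod (2 * n + 1), g k.valMinAbs = ∑ k ∈ Finset.Icc (-n : ℤ) n, g k := by
  refine Finset.sum_bij' (fun k _ => k.valMinAbs) (fun k _ => (k : ZMod (2 * n + 1))) ?_ ?_ ?_ ?_ ?_
  · intro k _
    have := k.valMinAbs_mem_Ioc
    simp only [mem_Ioc, Finset.mem_Icc] at *
    push_cast at this
    omega
  · simp
  · intro k _
    exact k.coe_valMinAbs
  · intro k hk
    rw [ZMod.valMinAbs_spec]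
    simp only [Finset.mem_Icc] at hk
    simp only [mem_Ioc]
    push_cast
    exact ⟨trivial, by omega, by omega⟩
  · simp

theorem sum_Icc_neg_eq_sum_range {E : Type*} [AddCommMonoid E] (n : ℕ) (g : ℤ → E) :
    ∑ k ∈ Finset.Icc (-n : ℤ) n, g k = ∑ l ∈ Finset.range (2 * n + 1), g (l - n) := by
  symm
  refine Finset.sum_bij' (fun l _ => (l - n : ℤ)) (fun k _ => (k + n).toNat) ?_ ?_ ?_ ?_ ?_
  all_goals intro k hk; simp only [Finset.mem_Icc, Finset.mem_range] at *
  all_goals omega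

/-- The nodes `-2πj / (2n + 1)`. -/
noncomputable def dftNode (n : ℕ) (j : ZMod (2 * n + 1)) : ℝ :=
  -(2 * Real.pi * j.val / (2 * n + 1 : ℕ))

/-- The discrete Fourier transform maps the coefficients of a trigonometric polynomial to its values
at the nodes. -/
theorem trigPoly_dftNode (n : ℕ) (c : ZMod (2 * n + 1) → ℂ) (j : ZMod (2 * n + 1)) :
    trigPoly n c (dftNode n j) = (𝓕 c) j := by
  rw [ZMod.dft_apply, trigPoly]
  refine Finset.sum_congr rfl fun k _ => ?_
  -- The minus sign in `dftNode` matches the transform's kernel, which depends on the frequency only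
  -- modulo 2n + 1.
  have h : -(k * j) = ((-(k.valMinAbs * j.val) : ℤ) : ZMod (2 * n + 1)) := by
    rw [Int.cast_neg, Int.cast_mul, ZMod.coe_valMinAbs, Int.cast_natCast, ZMod.natCast_val,
      ZMod.cast_id', id]
  rw [h, ZMod.stdAddChar_coe, smul_eq_mul, mul_comm, dftNode]
  congr 2
  push_cast
  ring

/-- Each coefficient is an average of values times unimodular characters. -/
theorem norm_invDFT_apply_le (m : ℕ) [NeZero m] (v : ZMod m → ℂ) (k : ZMod m) :
    ‖(𝓕⁻ v) k‖ ≤ ‖v‖ := by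
  rw [ZMod.invDFT_apply, norm_smul, norm_inv, Complex.norm_natCast]
  have hm : (0 : ℝ) < m := by exact_mod_cast NeZero.pos m
  rw [inv_mul_le_iff₀ hm]
  refine (norm_sum_le _ _).trans ?_
  calc _ ≤ ∑ j : ZMod m, ‖v‖ := by
        refine Finset.sum_le_sum fun j _ => ?_
        rw [norm_smul, AddChar.norm_apply, one_mul]
        exact norm_le_pi_norm v j
    _ = m * ‖v‖ := by simp [ZMod.card]

/-! ### The Dirichlet kernel and the Lebesgue constant of interpolation. -/

/-- The normalised modulus of the Dirichlet kernel. -/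
noncomputable def dirichletAbs (m : ℕ) (y : ℝ) : ℝ :=
  (m : ℝ)⁻¹ * ‖∑ l ∈ Finset.range m, Complex.exp (Complex.I * l * y)‖

theorem dirichletAbs_le_one (m : ℕ) (y : ℝ) : dirichletAbs m y ≤ 1 := by
  have : ‖∑ l ∈ Finset.range m, Complex.exp (Complex.I * l * y)‖ ≤ m := by
    refine (norm_sum_le _ _).trans (le_of_eq ?_)
    simp [Complex.norm_exp]
  rw [dirichletAbs]
  rcases Nat.eq_zero_or_pos m with rfl | hm
  · simp
  · rw [inv_mul_le_iff₀ (by exact_mod_cast hm), mul_one]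
    exact this

theorem dirichletAbs_periodic (m : ℕ) : Function.Periodic (dirichletAbs m) (2 * Real.pi) := by
  intro y
  unfold dirichletAbs
  congr 2
  refine Finset.sum_congr rfl fun l _ => ?_
  have := Complex.exp_periodic.nat_mul l (Complex.I * l * y)
  rw [← this]
  congr 1
  push_cast
  ring

/-- Geometric sum: the numerator has modulus at most 2, the denominator exactly 2 sin(y/2). -/
theorem dirichletAbs_le_inv_sin (m : ℕ) {y : ℝ} (hy : 0 < Real.sin (y / 2)) :
    dirichletAbs m y ≤ (m * Real.sin (y / 2))⁻¹ := by
  rw [dirichletAbs, mul_inv]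
  gcongr
  have hw : ‖Complex.exp (Complex.I * y) - 1‖ = 2 * Real.sin (y / 2) := by
    rw [Complex.norm_exp_I_mul_ofReal_sub_one, Real.norm_of_nonneg (by positivity)]
  have hgeom := mul_geom_sum (Complex.exp (Complex.I * y)) m
  have hs : ∑ l ∈ Finset.range m, Complex.exp (Complex.I * l * y) =
      ∑ l ∈ Finset.range m, Complex.exp (Complex.I * y) ^ l := by
    refine Finset.sum_congr rfl fun l _ => ?_
    rw [← Complex.exp_nat_mul]
    congr 1
    ring
  have hn := congrArg norm hgeom
  rw [norm_mul, hw, ← hs] at hn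
  have h2 : ‖Complex.exp (Complex.I * y) ^ m - 1‖ ≤ 2 := by
    refine (norm_sub_le _ _).trans ?_
    rw [norm_pow, mul_comm, Complex.norm_exp_ofReal_mul_I]
    norm_num
  rw [← hn] at h2
  rw [← one_div, le_div_iff₀ hy]
  linarith

/-- Away from the endpoints of a period the Dirichlet kernel is bounded by the reciprocals of the
distances to them. -/
theorem dirichletAbs_le {m : ℕ} (hm : 0 < m) {y : ℝ} (h0 : 0 < y) (h1 : y < 2 * Real.pi) :
    dirichletAbs m y ≤ Real.pi / (m * y) + Real.pi / (m * (2 * Real.pi - y)) := by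
  have hm' : (0 : ℝ) < m := by exact_mod_cast hm
  have hz : 0 < 2 * Real.pi - y := by linarith
  rcases le_total y Real.pi with h | h
  · have hs := Real.mul_le_sin (x := y / 2) (by linarith) (by linarith)
    have hpos : 0 < 2 / Real.pi * (y / 2) := by positivity
    refine (dirichletAbs_le_inv_sin m (hpos.trans_le hs)).trans ?_
    refine le_add_of_le_of_nonneg ?_ (by positivity)
    calc _ ≤ (m * (2 / Real.pi * (y / 2)))⁻¹ := by gcongr
      _ = _ := by field_simp
  · have hs := Real.mul_le_sin (x := Real.pi - y / 2) (by linarith) (by linarith)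
    rw [Real.sin_pi_sub] at hs
    have hpos : 0 < 2 / Real.pi * (Real.pi - y / 2) := by
      have : 0 < Real.pi - y / 2 := by linarith
      positivity
    refine (dirichletAbs_le_inv_sin m (hpos.trans_le hs)).trans ?_
    refine le_add_of_nonneg_of_le (by positivity) ?_
    calc _ ≤ (m * (2 / Real.pi * (Real.pi - y / 2)))⁻¹ := by gcongr
      _ = _ := by
        have : Real.pi - y / 2 = (2 * Real.pi - y) / 2 := by ring
        rw [this]; field_simp

/-- A shift by one node spacing permutes the nodes cyclically. -/
theorem sum_dirichletAbs_periodic (m : ℕ) (hm : 0 < m) :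
    Function.Periodic (fun x => ∑ j ∈ Finset.range m, dirichletAbs m (x + 2 * Real.pi * j / m))
      (2 * Real.pi / m) := by
  intro x
  have hm' : (m : ℝ) ≠ 0 := by exact_mod_cast hm.ne'
  have h := Finset.sum_range_succ (fun j : ℕ => dirichletAbs m (x + 2 * Real.pi * j / m)) m
  rw [Finset.sum_range_succ'] at h
  have hend : dirichletAbs m (x + 2 * Real.pi * m / m) =
      dirichletAbs m (x + 2 * Real.pi * (0 : ℕ) / m) := by
    rw [mul_div_cancel_right₀ _ hm', dirichletAbs_periodic]
    simp
  rw [hend, add_left_inj] at h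
  beta_reduce
  rw [← h]
  refine Finset.sum_congr rfl fun j _ => ?_
  congr 1
  push_cast
  ring

/-- The Lebesgue constant of trigonometric interpolation at `m` nodes grows logarithmically. -/
theorem sum_dirichletAbs_le {m : ℕ} (hm : 0 < m) (x : ℝ) :
    ∑ j ∈ Finset.range m, dirichletAbs m (x + 2 * Real.pi * j / m) ≤ 4 + Real.log m := by
  have hm' : (0 : ℝ) < m := by exact_mod_cast hm
  have hpi := Real.pi_pos
  obtain ⟨t, ht, hxt⟩ := (sum_dirichletAbs_periodic m hm).exists_mem_Ico₀
    (by positivity : 0 < 2 * Real.pi / m) x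
  rw [hxt]
  obtain ⟨p, rfl⟩ : ∃ p, m = p + 1 := ⟨m - 1, by omega⟩
  -- The two end nodes may be near a multiple of 2π and get the trivial bound 1. The others give two
  -- half harmonic sums, written so that `Finset.sum_range_reflect` merges them; the junk term is
  -- harmless as 0⁻¹ = 0.
  have hterm : ∀ j ∈ Finset.range (p + 1),
      dirichletAbs (p + 1) (t + 2 * Real.pi * j / (p + 1 : ℕ)) ≤
        ((if j = 0 then 1 else 0) + (if j = p then 1 else 0)) +
          ((j : ℝ)⁻¹ / 2 + ((p + 1 - 1 - j : ℕ) : ℝ)⁻¹ / 2) := by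
    intro j hj
    rw [Finset.mem_range] at hj
    by_cases h0 : j = 0 ∨ j = p
    · refine (dirichletAbs_le_one _ _).trans (le_add_of_le_of_nonneg ?_ (by positivity))
      rcases h0 with h | h
      · rw [if_pos h]; exact le_add_of_nonneg_right (by positivity)
      · rw [if_pos h]; exact le_add_of_nonneg_left (by positivity)
    · obtain ⟨h0, h1⟩ := not_or.1 h0
      rw [if_neg h0, if_neg h1, zero_add, zero_add]
      have hj0 : (0 : ℝ) < j := by exact_mod_cast Nat.pos_of_ne_zero h0
      have hq : ((p + 1 - 1 - j : ℕ) : ℝ) = p - j := by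
        rw [Nat.add_sub_cancel, Nat.cast_sub (by omega)]
      have hq0 : (0 : ℝ) < p - j := by
        rw [sub_pos]; exact_mod_cast (show j < p by omega)
      rw [hq]
      have e1 : 2 * Real.pi * j / (p + 1 : ℕ) ≤ t + 2 * Real.pi * j / (p + 1 : ℕ) := by
        linarith [ht.1]
      have e2 : 2 * Real.pi * (p - j) / (p + 1 : ℕ) ≤
          2 * Real.pi - (t + 2 * Real.pi * j / (p + 1 : ℕ)) := by
        have h3 : 2 * Real.pi = 2 * Real.pi / (p + 1 : ℕ) +
            2 * Real.pi * (p - j) / (p + 1 : ℕ) + 2 * Real.pi * j / (p + 1 : ℕ) := by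
          push_cast
          field_simp
          ring
        linarith [ht.2]
      have p1 : 0 < 2 * Real.pi * j / (p + 1 : ℕ) := by positivity
      have p2 : 0 < 2 * Real.pi * (p - j) / (p + 1 : ℕ) := by positivity
      refine (dirichletAbs_le hm (p1.trans_le e1) (by linarith)).trans (add_le_add ?_ ?_)
      · calc _ ≤ Real.pi / ((p + 1 : ℕ) * (2 * Real.pi * j / (p + 1 : ℕ))) := by gcongr
          _ = _ := by field_simp
      · calc _ ≤ Real.pi / ((p + 1 : ℕ) * (2 * Real.pi * (p - j) / (p + 1 : ℕ))) := by gcongr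
          _ = _ := by field_simp
  refine (Finset.sum_le_sum hterm).trans ?_
  rw [Finset.sum_add_distrib, Finset.sum_add_distrib, Finset.sum_add_distrib,
    Finset.sum_range_reflect (fun j : ℕ => (j : ℝ)⁻¹ / 2) (p + 1), Finset.sum_ite_eq',
    Finset.sum_ite_eq', if_pos (by simp), if_pos (by simp), ← Finset.sum_div, ← add_div,
    add_self_div_two, Finset.sum_range_succ']
  have hh := harmonic_le_one_add_log p
  have hlog : Real.log p ≤ Real.log (p + 1 : ℕ) := by
    rcases Nat.eq_zero_or_pos p with rfl | hp
    · simp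
    · exact Real.log_le_log (by exact_mod_cast hp) (by push_cast; linarith)
  simp only [harmonic] at hh
  push_cast at hh hlog ⊢
  simp only [inv_zero, add_zero]
  linarith

theorem norm_sum_exp_valMinAbs (n : ℕ) (y : ℝ) :
    ‖∑ k : ZMod (2 * n + 1), Complex.exp (Complex.I * k.valMinAbs * y)‖ =
      ‖∑ l ∈ Finset.range (2 * n + 1), Complex.exp (Complex.I * l * y)‖ := by
  rw [sum_valMinAbs n (fun k => Complex.exp (Complex.I * k * y)), sum_Icc_neg_eq_sum_range]
  have : ∀ l : ℕ, Complex.exp (Complex.I * ((l - n : ℤ) : ℂ) * y) =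
      Complex.exp ((-(n * y) : ℝ) * Complex.I) * Complex.exp (Complex.I * l * y) := by
    intro l
    rw [← Complex.exp_add]
    congr 1
    push_cast
    ring
  simp_rw [this]
  rw [← Finset.mul_sum, norm_mul, Complex.norm_exp_ofReal_mul_I, one_mul]

/-- The supremum norm of a trigonometric polynomial is controlled by its values at the nodes. -/
theorem norm_trigPoly_le (n : ℕ) (c : ZMod (2 * n + 1) → ℂ) (x : ℝ) :
    ‖trigPoly n c x‖ ≤ (4 + Real.log (2 * n + 1 : ℕ)) * ‖𝓕 c‖ := by
  have hc : ∀ k, c k = ((2 * n + 1 : ℕ) : ℂ)⁻¹ * ∑ j, ZMod.stdAddChar (j * k) * (𝓕 c) j := by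
    intro k
    have := ZMod.invDFT_apply (𝓕 c) k
    simpa using this
  have hchar : ∀ j k : ZMod (2 * n + 1), ZMod.stdAddChar (j * k) =
      Complex.exp (2 * Real.pi * Complex.I * (k.valMinAbs * j.val : ℤ) / (2 * n + 1 : ℕ)) := by
    intro j k
    rw [← ZMod.stdAddChar_coe, Int.cast_mul, ZMod.coe_valMinAbs, Int.cast_natCast,
      ZMod.natCast_val, ZMod.cast_id', id, mul_comm j k]
  -- Lagrange form of trigonometric interpolation: the weights are translated, normalised Dirichlet
  -- kernels.
  have hp : trigPoly n c x = ∑ j, (𝓕 c) j * (((2 * n + 1 : ℕ) : ℂ)⁻¹ *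
      ∑ k : ZMod (2 * n + 1), Complex.exp (Complex.I * k.valMinAbs *
        (x + 2 * Real.pi * j.val / (2 * n + 1 : ℕ) : ℝ))) := by
    rw [trigPoly]
    simp_rw [Finset.mul_sum]
    rw [Finset.sum_comm]
    refine Finset.sum_congr rfl fun k _ => ?_
    conv_lhs => rw [hc k, Finset.mul_sum, Finset.sum_mul]
    refine Finset.sum_congr rfl fun j _ => ?_
    rw [hchar, show Complex.I * k.valMinAbs * (x + 2 * Real.pi * j.val / (2 * n + 1 : ℕ) : ℝ) =
      2 * Real.pi * Complex.I * (k.valMinAbs * j.val : ℤ) / (2 * n + 1 : ℕ) +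
        Complex.I * k.valMinAbs * x by push_cast; ring, Complex.exp_add]
    ring
  rw [hp]
  refine (norm_sum_le _ _).trans ?_
  calc _ ≤ ∑ j : ZMod (2 * n + 1), ‖𝓕 c‖ *
        dirichletAbs (2 * n + 1) (x + 2 * Real.pi * j.val / (2 * n + 1 : ℕ)) := by
        refine Finset.sum_le_sum fun j _ => ?_
        rw [norm_mul, norm_mul, norm_inv, Complex.norm_natCast, norm_sum_exp_valMinAbs]
        exact mul_le_mul_of_nonneg_right (norm_le_pi_norm _ j) (by positivity)
    _ = ‖𝓕 c‖ * ∑ j ∈ Finset.range (2 * n + 1),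
        dirichletAbs (2 * n + 1) (x + 2 * Real.pi * j / (2 * n + 1 : ℕ)) := by
        rw [← Finset.mul_sum]
        congr 1
        exact Fin.sum_univ_eq_sum_range
          (fun j => dirichletAbs (2 * n + 1) (x + 2 * Real.pi * j / (2 * n + 1 : ℕ))) (2 * n + 1)
    _ ≤ _ := by
        rw [mul_comm]
        gcongr
        exact sum_dirichletAbs_le (Nat.succ_pos _) x

/-! ### Volumes of coefficient boxes and packing. -/

/-- The coefficient vectors whose entries are bounded by `ρ`. -/
def coeffBox {ι : Type*} (ρ : ι → ℝ) : Set (ι → ℂ) := {c | ∀ k, ‖c k‖ ≤ ρ k}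

theorem volume_coeffBox {ι : Type*} [Fintype ι] {ρ : ι → ℝ} (hρ : ∀ k, 0 ≤ ρ k) :
    volume (coeffBox ρ) = ENNReal.ofReal (∏ k, Real.pi * ρ k ^ 2) := by
  have h : coeffBox ρ = Set.pi univ fun k => Metric.closedBall (0 : ℂ) (ρ k) := by
    ext c; simp [coeffBox]
  rw [h, volume_pi_pi, ENNReal.ofReal_prod_of_nonneg (fun k _ => by positivity)]
  refine Finset.prod_congr rfl fun k _ => ?_
  rw [Complex.volume_closedBall, ENNReal.ofReal_mul Real.pi_pos.le, ENNReal.ofReal_pow (hρ k),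
    mul_comm]
  congr 1
  exact (ENNReal.ofReal_coe_nnreal (p := NNReal.pi)).symm

theorem volume_image_dft_coeffBox {m : ℕ} [NeZero m] {ρ : ZMod m → ℝ} (hρ : ∀ k, 0 ≤ ρ k) :
    volume ((fun v => 𝓕 v : (ZMod m → ℂ) → (ZMod m → ℂ)) '' coeffBox ρ) =
      ENNReal.ofReal ((m : ℝ) ^ m * ∏ k, Real.pi * ρ k ^ 2) := by
  rw [volume_image_dft, volume_coeffBox hρ, ENNReal.ofReal_mul (by positivity),
    ENNReal.ofReal_pow (by positivity), ENNReal.ofReal_natCast]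

theorem volume_closedBall_complex_pi {ι : Type*} [Fintype ι] (v : ι → ℂ) {r : ℝ} (hr : 0 ≤ r) :
    volume (Metric.closedBall v r) = ENNReal.ofReal ((Real.pi * r ^ 2) ^ Fintype.card ι) := by
  have h0 : coeffBox (fun _ : ι => r) = Metric.closedBall (0 : ι → ℂ) r := by
    ext c; simp [coeffBox, pi_norm_le_iff_of_nonneg hr]
  have := volume_coeffBox (ι := ι) (ρ := fun _ => r) fun _ => hr
  rw [h0] at this
  rw [Measure.addHaar_closedBall_center, this, Finset.prod_const, Finset.card_univ]

/-- Separated subsets of the image of a coefficient box under the discrete Fourier transform. -/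
theorem card_le_of_separated {m : ℕ} [NeZero m] {ρ : ZMod m → ℝ} (hρ : ∀ k, 0 ≤ ρ k) {r : ℝ}
    (hr : 0 < r) (C : Finset (ZMod m → ℂ))
    (hC : (C : Set (ZMod m → ℂ)) ⊆ (fun v => 𝓕 v) '' coeffBox ρ)
    (hsep : (C : Set (ZMod m → ℂ)).Pairwise (r < dist · ·)) :
    (C.card : ℝ) ≤ (m : ℝ) ^ m * ∏ k, (1 + 2 * ρ k / r) ^ 2 := by
  -- The inverse transform does not increase the sup norm, so radius r/2 on the value side widens
  -- the box by at most r/2. Disjointness of these balls then bounds their number.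
  have hsub : (⋃ v ∈ C, Metric.closedBall v (r / 2)) ⊆
      (fun v => 𝓕 v) '' coeffBox (fun k => ρ k + r / 2) := by
    refine iUnion₂_subset fun v hv w hw => ?_
    obtain ⟨c, hc, rfl⟩ := hC hv
    refine ⟨𝓕⁻ w, fun k => ?_, ZMod.dft.apply_symm_apply w⟩
    have h1 : (𝓕⁻ w) k = c k + (𝓕⁻ (w - 𝓕 c)) k := by
      have h2 : 𝓕⁻ (w - 𝓕 c) = 𝓕⁻ w - c := by
        have h3 : ZMod.dft.symm (w - ZMod.dft c) = ZMod.dft.symm w - c := by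
          rw [map_sub, LinearEquiv.symm_apply_apply]
        exact h3
      rw [h2, Pi.sub_apply, add_sub_cancel]
    rw [h1]
    refine (norm_add_le _ _).trans (add_le_add (hc k) ?_)
    refine (norm_invDFT_apply_le m _ k).trans ?_
    rwa [← dist_eq_norm]
  have hdisj : (C : Set (ZMod m → ℂ)).PairwiseDisjoint fun v => Metric.closedBall v (r / 2) := by
    intro v hv w hw hvw
    refine Metric.closedBall_disjoint_closedBall ?_
    have := hsep hv hw hvw
    linarith
  have hvol := measure_mono (μ := volume) hsub
  rw [measure_biUnion_finset hdisj fun v _ => measurableSet_closedBall,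
    volume_image_dft_coeffBox (fun k => by have := hρ k; positivity)] at hvol
  simp_rw [volume_closedBall_complex_pi _ (half_pos hr).le] at hvol
  rw [Finset.sum_const, nsmul_eq_mul, ← ENNReal.ofReal_natCast, ← ENNReal.ofReal_mul (by positivity),
    ENNReal.ofReal_le_ofReal_iff (by positivity), ZMod.card] at hvol
  have hpos : 0 < (Real.pi * (r / 2) ^ 2) ^ m := by positivity
  refine le_of_mul_le_mul_right (hvol.trans_eq ?_) hpos
  have hcard : (Real.pi * (r / 2) ^ 2) ^ m = ∏ k : ZMod m, Real.pi * (r / 2) ^ 2 := by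
    rw [Finset.prod_const, Finset.card_univ, ZMod.card]
  rw [hcard, mul_assoc, ← Finset.prod_mul_distrib]
  congr 1
  refine Finset.prod_congr rfl fun k _ => ?_
  field_simp
  ring

theorem packingNumber_le {m : ℕ} [NeZero m] {ρ : ZMod m → ℝ} (hρ : ∀ k, 0 ≤ ρ k) {r : ℝ}
    (hr : 0 < r) {V : Set (ZMod m → ℂ)} (hV : V ⊆ (fun v => 𝓕 v) '' coeffBox ρ) :
    Metric.packingNumber r.toNNReal V ≤
      (⌊(m : ℝ) ^ m * ∏ k, (1 + 2 * ρ k / r) ^ 2⌋₊ : ℕ∞) := by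
  refine iSup_le fun C => iSup_le fun hC => iSup_le fun hsep => ?_
  by_contra! hlt
  -- The separated set may be infinite; a finite subset with one point too many already contradicts
  -- the volume bound.
  obtain ⟨t, htC, ht⟩ := Set.exists_subset_encard_eq (Order.add_one_le_of_lt hlt)
  have hfin : t.Finite := Set.finite_of_encard_eq_coe (by exact_mod_cast ht)
  have hcard := card_le_of_separated hρ hr hfin.toFinset
    (by rw [hfin.coe_toFinset]; exact (htC.trans hC).trans hV)
    (by
      rw [hfin.coe_toFinset]
      intro v hv w hw hvw
      have := hsep (htC hv) (htC hw) hvw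
      simp only [edist_dist] at this
      exact (ENNReal.ofReal_lt_ofReal_iff_of_nonneg hr.le).1 this)
  rw [hfin.encard_eq_coe_toFinset_card] at ht
  have h2 := Nat.le_floor hcard
  have h3 : hfin.toFinset.card = ⌊(m : ℝ) ^ m * ∏ k, (1 + 2 * ρ k / r) ^ 2⌋₊ + 1 := by
    exact_mod_cast ht
  omega

/-! ### Exponential tails and truncation of Fourier series. -/

theorem hasSum_nat_tail {s : ℝ} (hs : 0 < s) (p : ℕ) :
    HasSum (fun l : ℕ => if l < p then 0 else Real.exp (-s * l))
      (Real.exp (-s * p) * (1 - Real.exp (-s))⁻¹) := by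
  rw [← hasSum_nat_add_iff' p, Finset.sum_eq_zero, sub_zero]
  · have := (hasSum_geometric_of_lt_one (Real.exp_pos (-s)).le (by simpa using hs)).mul_left
      (Real.exp (-s * p))
    refine this.congr_fun fun l => ?_
    rw [if_neg (by omega), ← Real.exp_nat_mul, ← Real.exp_add]
    congr 1
    push_cast
    ring
  · intro l hl
    rw [if_pos (Finset.mem_range.1 hl)]

theorem hasSum_int_tail {s : ℝ} (hs : 0 < s) (n : ℕ) :
    HasSum (fun k : ℤ => if k ∈ Finset.Icc (-n : ℤ) n then 0 else Real.exp (-s * |(k : ℝ)|))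
      (2 * Real.exp (-s * (n + 1)) * (1 - Real.exp (-s))⁻¹) := by
  have h1 := hasSum_nat_tail hs (n + 1)
  have h2 := (hasSum_nat_add_iff' 1).2 h1
  rw [Finset.sum_range_one, if_pos (Nat.succ_pos n), sub_zero] at h2
  have h3 := HasSum.of_nat_of_neg_add_one
    (f := fun k : ℤ => if k ∈ Finset.Icc (-n : ℤ) n then 0 else Real.exp (-s * |(k : ℝ)|))
    (h1.congr_fun fun l => by simp [show (-(n : ℤ) ≤ l) by omega])
    (h2.congr_fun fun l => by
      have e1 : -((l : ℤ) + 1) ∈ Finset.Icc (-n : ℤ) n ↔ l + 1 < n + 1 := by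
        rw [Finset.mem_Icc]; omega
      have e2 : |((-((l : ℤ) + 1) : ℤ) : ℝ)| = (l + 1 : ℕ) := by
        push_cast
        rw [abs_neg, abs_of_nonneg (by positivity)]
      simp only [e1, e2])
  convert! h3 using 1
  push_cast
  ring

/-- Truncation of a Fourier expansion with exponentially decaying coefficients. -/
theorem norm_sub_trigPoly_le {s M : ℝ} (hs : 0 < s) {c : ℤ → ℂ} {y : ℂ} {x : ℝ}
    (hc : ∀ k, ‖c k‖ ≤ M * Real.exp (-s * |(k : ℝ)|))
    (hy : HasSum (fun k => c k * Complex.exp (Complex.I * k * x)) y) (n : ℕ) :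
    ‖y - trigPoly n (fun k => c k.valMinAbs) x‖ ≤
      2 * M * (1 - Real.exp (-s))⁻¹ * Real.exp (-s * n) := by
  have h1 : trigPoly n (fun k => c k.valMinAbs) x =
      ∑ k ∈ Finset.Icc (-n : ℤ) n, c k * Complex.exp (Complex.I * k * x) :=
    sum_valMinAbs n fun k => c k * Complex.exp (Complex.I * k * x)
  have h2 := hasSum_sum_of_ne_finset_zero
    (f := fun k : ℤ => if k ∈ Finset.Icc (-n : ℤ) n then c k * Complex.exp (Complex.I * k * x) else 0)
    (s := Finset.Icc (-n : ℤ) n) (fun k hk => if_neg hk) (L := SummationFilter.unconditional ℤ)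
  rw [Finset.sum_congr rfl fun k hk => if_pos hk, ← h1] at h2
  have h3 := hy.sub h2
  have hM : 0 ≤ M := by simpa using (norm_nonneg _).trans (hc 0)
  rw [← h3.tsum_eq]
  refine (tsum_of_norm_bounded ((hasSum_int_tail hs n).mul_left M) fun k => ?_).trans ?_
  · split_ifs with hk
    · simp
    · rw [sub_zero, norm_mul, Complex.norm_exp]
      simpa using hc k
  · have hle : Real.exp (-s * (n + 1)) ≤ Real.exp (-s * n) := by
      apply Real.exp_le_exp.2; nlinarith
    have : 0 < 1 - Real.exp (-s) := by simpa using hs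
    calc M * (2 * Real.exp (-s * (n + 1)) * (1 - Real.exp (-s))⁻¹) =
        2 * M * (1 - Real.exp (-s))⁻¹ * Real.exp (-s * (n + 1)) := by ring
      _ ≤ _ := by gcongr

/-! ### Volume bounds for the covering number. -/

theorem norm_cexp_I_mul_int_mul (k : ℤ) (z : ℂ) :
    ‖Complex.exp (Complex.I * k * z)‖ = Real.exp (-(k * z.im)) := by
  rw [Complex.norm_exp]
  congr 1
  simp

/-- A trigonometric polynomial as a bounded periodic function. -/
noncomputable def trigPolyFun (n : ℕ) (c : ZMod (2 * n + 1) → ℂ) : PeriodicFun where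
  toFun := trigPoly n c
  periodic' x := by
    refine Finset.sum_congr rfl fun k _ => ?_
    congr 1
    rw [← Complex.exp_periodic.int_mul k.valMinAbs (Complex.I * k.valMinAbs * x)]
    congr 1
    push_cast
    ring
  bounded' := by
    refine ⟨∑ k, ‖c k‖, fun x => (norm_sum_le _ _).trans (Finset.sum_le_sum fun k _ => ?_)⟩
    rw [norm_mul, norm_cexp_I_mul_int_mul]
    simp

/-- In the strip the growth e^{s|k|} of each exponential cancels the decay of its coefficient, so
each of the 2n + 1 terms is at most M/(2n + 1). -/
theorem trigPolyFun_mem {s M : ℝ} {n : ℕ} {c : ZMod (2 * n + 1) → ℂ}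
    (hc : c ∈ coeffBox fun k => M * Real.exp (-s * |(k.valMinAbs : ℝ)|) / (2 * n + 1 : ℕ)) :
    trigPolyFun n c ∈ analyticStripClass s M := by
  refine ⟨fun z => ∑ k, c k * Complex.exp (Complex.I * k.valMinAbs * z), ?_, fun x => rfl, ?_⟩
  · intro z _
    fun_prop
  · intro z hz
    have hm : (0 : ℝ) < (2 * n + 1 : ℕ) := by positivity
    have hM : 0 ≤ M := by
      have := (norm_nonneg _).trans (hc 0)
      simpa using (le_div_iff₀ hm).1 this
    calc _ ≤ ∑ k : ZMod (2 * n + 1), M / (2 * n + 1 : ℕ) := by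
          refine (norm_sum_le _ _).trans (Finset.sum_le_sum fun k _ => ?_)
          rw [norm_mul, norm_cexp_I_mul_int_mul]
          have h1 : Real.exp (-(k.valMinAbs * z.im)) ≤ Real.exp (s * |(k.valMinAbs : ℝ)|) := by
            apply Real.exp_le_exp.2
            refine (neg_le_abs _).trans ?_
            rw [abs_mul, mul_comm]
            gcongr
            exact le_of_lt hz
          refine (mul_le_mul (hc k) h1 (Real.exp_pos _).le ((norm_nonneg _).trans (hc k))).trans_eq ?_
          rw [div_mul_eq_mul_div, mul_assoc, ← Real.exp_add]
          simp
      _ = M := by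
          rw [Finset.sum_const, Finset.card_univ, ZMod.card, nsmul_eq_mul]
          field_simp

theorem dist_le_of_forall {f g : PeriodicFun} {ε : ℝ} (h : ∀ x, ‖f x - g x‖ ≤ ε) :
    dist f g ≤ ε := ciSup_le fun x => h x

theorem exists_isCover_encard_eq_externalCoveringNumber {Y : Type*} [PseudoEMetricSpace Y]
    (ε : NNReal) (A : Set Y) :
    ∃ C : Set Y, Metric.IsCover ε A C ∧ C.encard = Metric.externalCoveringNumber ε A := by
  have : Nonempty {C : Set Y // Metric.IsCover ε A C} := ⟨A, .rfl⟩
  obtain ⟨C, hC⟩ := ENat.exists_eq_iInf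
    (fun C : {C : Set Y // Metric.IsCover ε A C} => (C : Set Y).encard)
  exact ⟨C, C.2, hC.trans iInf_subtype⟩

/-- Volume lower bound for the number of balls that cover the class. -/
theorem le_externalCoveringNumber {s M : ℝ} (hM : 0 < M) {X : Set PeriodicFun}
    (hX : analyticStripClass s M ⊆ X) {ε : ℝ} (hε : 0 < ε) (n : ℕ)
    (hfin : Metric.externalCoveringNumber ε.toNNReal
      ((↑) ⁻¹' analyticStripClass s M : Set X) ≠ ⊤) :
    ((2 * n + 1 : ℕ) : ℝ) ^ (2 * n + 1) * ∏ k : ZMod (2 * n + 1),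
        (M * Real.exp (-s * |(k.valMinAbs : ℝ)|) / (2 * n + 1 : ℕ) / ε) ^ 2 ≤
      ((Metric.externalCoveringNumber ε.toNNReal
        ((↑) ⁻¹' analyticStripClass s M : Set X)).toNat : ℝ) := by
  obtain ⟨C, hC, hCenc⟩ := exists_isCover_encard_eq_externalCoveringNumber ε.toNNReal
    ((↑) ⁻¹' analyticStripClass s M : Set X)
  -- Without `hfin` the bound could fail, since `ENat.toNat ⊤ = 0`.
  have hCfin : C.Finite := by
    rw [← Set.encard_ne_top_iff, hCenc]; exact hfin
  rw [← hCenc, hCfin.encard_eq_coe_toFinset_card, ENat.toNat_natCast]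
  set ρ : ZMod (2 * n + 1) → ℝ :=
    fun k => M * Real.exp (-s * |(k.valMinAbs : ℝ)|) / (2 * n + 1 : ℕ) with hρ
  have hρ0 : ∀ k, 0 ≤ ρ k := fun k => by positivity
  have hsub : (fun v => 𝓕 v) '' coeffBox ρ ⊆
      ⋃ g ∈ hCfin.toFinset, Metric.closedBall (fun j => (g : PeriodicFun) (dftNode n j)) ε := by
    rintro _ ⟨c, hc, rfl⟩
    have hmem := trigPolyFun_mem hc
    obtain ⟨g, hg, hd⟩ := hC (show (⟨trigPolyFun n c, hX hmem⟩ : X) ∈ _ from hmem)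
    simp only [mem_iUnion]
    refine ⟨g, hCfin.mem_toFinset.2 hg, ?_⟩
    rw [Metric.mem_closedBall, dist_pi_le_iff hε.le]
    intro j
    rw [dist_eq_norm, ← trigPoly_dftNode]
    refine (norm_sub_le_periodicDist (trigPolyFun n c) g _).trans ?_
    have h2 : edist (trigPolyFun n c) (g : PeriodicFun) ≤ ENNReal.ofReal ε := hd
    rw [edist_dist] at h2
    exact (ENNReal.ofReal_le_ofReal_iff hε.le).1 h2
  have hvol := (measure_mono (μ := volume) hsub).trans (measure_biUnion_finset_le _ _)
  rw [volume_image_dft_coeffBox hρ0] at hvol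
  simp_rw [volume_closedBall_complex_pi _ hε.le] at hvol
  rw [Finset.sum_const, nsmul_eq_mul, ← ENNReal.ofReal_natCast, ← ENNReal.ofReal_mul (by positivity),
    ENNReal.ofReal_le_ofReal_iff (by positivity), ZMod.card] at hvol
  have hpos : 0 < (Real.pi * ε ^ 2) ^ (2 * n + 1) := by positivity
  refine le_of_mul_le_mul_right (le_of_eq_of_le ?_ hvol) hpos
  have hcard : (Real.pi * ε ^ 2) ^ (2 * n + 1) = ∏ k : ZMod (2 * n + 1), Real.pi * ε ^ 2 := by
    rw [Finset.prod_const, Finset.card_univ, ZMod.card]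
  rw [hcard, mul_assoc, ← Finset.prod_mul_distrib]
  congr 1
  refine Finset.prod_congr rfl fun k _ => ?_
  change _ = Real.pi * (M * Real.exp (-s * |(k.valMinAbs : ℝ)|) / (2 * n + 1 : ℕ)) ^ 2
  field_simp

/-- Volume upper bound for the number of balls that cover the class. -/
theorem externalCoveringNumber_le {s M : ℝ} (hs : 0 < s) (hM : 0 < M) {X : Set PeriodicFun}
    (hX : analyticStripClass s M ⊆ X) {ε r : ℝ} (hr : 0 < r) (n : ℕ)
    (hn : (4 + Real.log (2 * n + 1 : ℕ)) * r +
      2 * (2 * M * (1 - Real.exp (-s))⁻¹ * Real.exp (-s * n)) ≤ ε) :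
    Metric.externalCoveringNumber ε.toNNReal ((↑) ⁻¹' analyticStripClass s M : Set X) ≤
      (⌊((2 * n + 1 : ℕ) : ℝ) ^ (2 * n + 1) * ∏ k : ZMod (2 * n + 1),
        (1 + 2 * (M * Real.exp (-s * |(k.valMinAbs : ℝ)|)) / r) ^ 2⌋₊ : ℕ∞) := by
  choose! c hc hsum using fun f (hf : f ∈ analyticStripClass s M) => exists_fourier_expansion hs hf
  let T : PeriodicFun → (ZMod (2 * n + 1) → ℂ) := fun f k => c f k.valMinAbs
  let V : Set (ZMod (2 * n + 1) → ℂ) := (fun f => 𝓕 (T f)) '' analyticStripClass s M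
  have hV : V ⊆ (fun v => 𝓕 v) '' coeffBox fun k : ZMod (2 * n + 1) =>
      M * Real.exp (-s * |(k.valMinAbs : ℝ)|) := by
    rintro _ ⟨f, hf, rfl⟩
    exact ⟨T f, fun k => hc f hf _, rfl⟩
  -- A maximal separated set is a cover with centres inside V, so each centre lifts to a function of
  -- the class.
  have hpack := packingNumber_le (fun k => by positivity) hr hV
  have hcov := (Metric.coveringNumber_le_packingNumber r.toNNReal V).trans hpack
  obtain ⟨C, hCV, -, hC, hCenc⟩ := Metric.exists_set_encard_eq_coveringNumber
    (ne_top_of_le_ne_top (ENat.natCast_ne_top _) hcov)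
  have hlift : ∀ v : C, ∃ f : X, (f : PeriodicFun) ∈ analyticStripClass s M ∧ 𝓕 (T f) = v := by
    intro v
    obtain ⟨f, hf, hfv⟩ := hCV v.2
    exact ⟨⟨f, hX hf⟩, hf, hfv⟩
  choose φ hφ hφv using hlift
  have hcover : Metric.IsCover ε.toNNReal ((↑) ⁻¹' analyticStripClass s M : Set X) (range φ) := by
    intro f hf
    have hf' : (f : PeriodicFun) ∈ analyticStripClass s M := hf
    obtain ⟨v, hv, hd⟩ := hC (mem_image_of_mem (fun f => 𝓕 (T f)) hf')
    refine ⟨φ ⟨v, hv⟩, mem_range_self _, ?_⟩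
    have hd' : dist (𝓕 (T f)) v ≤ r := by
      have h2 : edist (𝓕 (T f)) v ≤ ENNReal.ofReal r := hd
      rw [edist_dist] at h2
      exact (ENNReal.ofReal_le_ofReal_iff hr.le).1 h2
    rw [show v = 𝓕 (T (φ ⟨v, hv⟩)) from (hφv ⟨v, hv⟩).symm, dist_eq_norm] at hd'
    have hg := hφ ⟨v, hv⟩
    set g := φ ⟨v, hv⟩
    have hdist : dist (f : PeriodicFun) (g : PeriodicFun) ≤ ε := by
      refine dist_le_of_forall fun x => le_trans ?_ hn
      have h1 := norm_sub_trigPoly_le hs (hc _ hf') (hsum _ hf' x) n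
      have h2 := norm_sub_trigPoly_le hs (hc _ hg) (hsum _ hg x) n
      have h3 := norm_trigPoly_le n (T f - T g) x
      have h4 : trigPoly n (T f - T g) x = trigPoly n (T f) x - trigPoly n (T g) x := by
        simp only [trigPoly, Pi.sub_apply, sub_mul, Finset.sum_sub_distrib]
      have h5 : 𝓕 (T f - T g) = 𝓕 (T f) - 𝓕 (T g) := map_sub ZMod.dft _ _
      rw [h4, h5] at h3
      have hlog : 0 ≤ Real.log (2 * n + 1 : ℕ) := Real.log_natCast_nonneg _
      have h6 := h3.trans (mul_le_mul_of_nonneg_left hd' (by linarith))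
      -- Two truncation errors plus the difference of polynomials; hence the factor 2 in `hn`.
      have h7 : (f : PeriodicFun) x - (g : PeriodicFun) x =
          (trigPoly n (T f) x - trigPoly n (T g) x) + ((f : PeriodicFun) x - trigPoly n (T f) x) -
            ((g : PeriodicFun) x - trigPoly n (T g) x) := by ring
      rw [h7]
      refine (norm_sub_le _ _).trans ((add_le_add_left (norm_add_le _ _) _).trans ?_)
      linarith
    show edist (f : PeriodicFun) (g : PeriodicFun) ≤ ENNReal.ofReal ε
    rw [edist_dist]
    exact ENNReal.ofReal_le_ofReal hdist
  refine hcover.externalCoveringNumber_le_encard.trans (le_trans ?_ hcov)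
  rw [← hCenc, ← image_univ]
  refine (encard_image_le _ _).trans ?_
  rw [encard_univ, Set.encard]

/-! ### Logarithms of the volume bounds at the cutoff frequency. -/

theorem sum_abs_valMinAbs (n : ℕ) :
    ∑ k : ZMod (2 * n + 1), |(k.valMinAbs : ℝ)| = n * (n + 1) := by
  rw [sum_valMinAbs n (fun k : ℤ => |(k : ℝ)|), sum_Icc_neg_eq_sum_range,
    show 2 * n + 1 = n + (n + 1) by ring, Finset.sum_range_add]
  have h1 : ∑ l ∈ Finset.range n, |(((l : ℤ) - n : ℤ) : ℝ)| = ∑ l ∈ Finset.range n, ((n : ℝ) - l) := by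
    refine Finset.sum_congr rfl fun l hl => ?_
    have : (l : ℝ) ≤ n := by exact_mod_cast (Finset.mem_range.1 hl).le
    push_cast
    rw [abs_sub_comm, abs_of_nonneg (by linarith)]
  have h2 : ∀ l : ℕ, |((((n + l : ℕ) : ℤ) - n : ℤ) : ℝ)| = l := by
    intro l
    push_cast
    rw [add_sub_cancel_left, abs_of_nonneg (by positivity)]
  have h3 : ∀ p : ℕ, ∑ l ∈ Finset.range p, (l : ℝ) = p * (p - 1) / 2 := by
    intro p
    induction p with
    | zero => simp
    | succ p ih => rw [Finset.sum_range_succ, ih]; push_cast; ring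
  rw [h1, Finset.sum_congr rfl fun l _ => h2 l, Finset.sum_sub_distrib, h3, h3]
  simp
  ring

/-- The logarithm of the products in the volume bounds. -/
theorem log_pow_mul_prod_sq {s A : ℝ} (hA : 0 < A) (n : ℕ) :
    Real.log (((2 * n + 1 : ℕ) : ℝ) ^ (2 * n + 1) * ∏ k : ZMod (2 * n + 1),
      (A * Real.exp (-s * |(k.valMinAbs : ℝ)|)) ^ 2) =
    (2 * n + 1 : ℕ) * Real.log (2 * n + 1 : ℕ) + 2 * (2 * n + 1 : ℕ) * Real.log A
      - 2 * s * (n * (n + 1)) := by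
  rw [Real.log_mul (by positivity) (by positivity), Real.log_pow, Real.log_prod (fun k _ => by positivity)]
  have : ∀ k : ZMod (2 * n + 1), Real.log ((A * Real.exp (-s * |(k.valMinAbs : ℝ)|)) ^ 2) =
      2 * Real.log A - 2 * s * |(k.valMinAbs : ℝ)| := by
    intro k
    rw [Real.log_pow, Real.log_mul hA.ne' (Real.exp_pos _).ne', Real.log_exp]
    push_cast
    ring
  simp_rw [this]
  rw [Finset.sum_sub_distrib, ← Finset.mul_sum (f := fun k : ZMod (2 * n + 1) => |(k.valMinAbs : ℝ)|),
    sum_abs_valMinAbs, Finset.sum_const,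
    Finset.card_univ, ZMod.card, nsmul_eq_mul]
  ring

theorem abs_valMinAbs_le (n : ℕ) (k : ZMod (2 * n + 1)) : |(k.valMinAbs : ℝ)| ≤ n := by
  have h := k.natAbs_valMinAbs_le
  rw [← Int.cast_abs, Int.abs_eq_natAbs]
  have : k.valMinAbs.natAbs ≤ n := by omega
  exact_mod_cast this

/-- The number of frequencies used at scale `ε`. -/
noncomputable def cutoff (s K ε : ℝ) : ℕ := ⌈(Real.log ε⁻¹ + Real.log K) / s⌉₊

theorem exp_cutoff_le {s K ε : ℝ} (hs : 0 < s) (hK : 0 < K) (hε : 0 < ε) :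
    K * Real.exp (-s * cutoff s K ε) ≤ ε := by
  have h := Nat.le_ceil ((Real.log ε⁻¹ + Real.log K) / s)
  rw [div_le_iff₀ hs] at h
  have : Real.exp (-s * cutoff s K ε) ≤ Real.exp (-(Real.log ε⁻¹ + Real.log K)) := by
    apply Real.exp_le_exp.2
    rw [cutoff]
    linarith
  refine (mul_le_mul_of_nonneg_left this hK.le).trans_eq ?_
  rw [Real.log_inv, neg_add, neg_neg, Real.exp_add, Real.exp_log hε, ← Real.log_inv,
    Real.exp_log (inv_pos.2 hK)]
  field_simp

/-- Rounding up overshoots by less than one, which costs e^s. Nonnegativity is needed because `⌈·⌉₊`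
stops at 0. -/
theorem le_exp_cutoff {s K ε : ℝ} (hs : 0 < s) (hK : 0 < K) (hε : 0 < ε)
    (h0 : 0 ≤ Real.log ε⁻¹ + Real.log K) :
    ε ≤ K * Real.exp s * Real.exp (-s * cutoff s K ε) := by
  have h := Nat.ceil_lt_add_one (div_nonneg h0 hs.le)
  rw [← sub_lt_iff_lt_add, lt_div_iff₀ hs] at h
  have : Real.exp (-(Real.log ε⁻¹ + Real.log K)) ≤
      Real.exp s * Real.exp (-s * cutoff s K ε) := by
    rw [← Real.exp_add]
    apply Real.exp_le_exp.2
    rw [cutoff]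
    linarith
  rw [mul_assoc]
  refine le_trans (le_of_eq ?_) (mul_le_mul_of_nonneg_left this hK.le)
  rw [Real.log_inv, neg_add, neg_neg, Real.exp_add, Real.exp_log hε, ← Real.log_inv,
    Real.exp_log (inv_pos.2 hK)]
  field_simp

/-- The constant 8 keeps the two tails within ε/2 together; the mesh r = ε/(2(4 + ln m)), m = 2n +
1, spends the other half. -/
theorem externalCoveringNumber_le_cutoff {s M : ℝ} (hs : 0 < s) (hM : 0 < M)
    {X : Set PeriodicFun} (hX : analyticStripClass s M ⊆ X) {ε : ℝ} (hε : 0 < ε) {n : ℕ}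
    (hn : n = cutoff s (8 * M * (1 - Real.exp (-s))⁻¹) ε) :
    Metric.externalCoveringNumber ε.toNNReal ((↑) ⁻¹' analyticStripClass s M : Set X) ≤
      (⌊((2 * n + 1 : ℕ) : ℝ) ^ (2 * n + 1) * ∏ k : ZMod (2 * n + 1),
        (1 + 2 * (M * Real.exp (-s * |(k.valMinAbs : ℝ)|)) /
          (ε / (2 * (4 + Real.log (2 * n + 1 : ℕ))))) ^ 2⌋₊ : ℕ∞) := by
  have hlog : 0 ≤ Real.log (2 * n + 1 : ℕ) := Real.log_natCast_nonneg _
  have h1 : 0 < 1 - Real.exp (-s) := by simpa using hs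
  refine externalCoveringNumber_le hs hM hX (by positivity) n ?_
  have h2 := exp_cutoff_le hs (K := 8 * M * (1 - Real.exp (-s))⁻¹) (by positivity) hε
  rw [← hn] at h2
  have h3 : (4 + Real.log (2 * n + 1 : ℕ)) * (ε / (2 * (4 + Real.log (2 * n + 1 : ℕ)))) = ε / 2 := by
    field_simp
  linarith

theorem le_log_of_volume_bound {s M ε N : ℝ} (hM : 0 < M) (hε : 0 < ε) {n : ℕ}
    (h : ((2 * n + 1 : ℕ) : ℝ) ^ (2 * n + 1) * ∏ k : ZMod (2 * n + 1),
      (M * Real.exp (-s * |(k.valMinAbs : ℝ)|) / (2 * n + 1 : ℕ) / ε) ^ 2 ≤ N) :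
    2 * (2 * n + 1 : ℕ) * (Real.log M + Real.log ε⁻¹) - (2 * n + 1 : ℕ) * Real.log (2 * n + 1 : ℕ)
      - 2 * s * (n * (n + 1)) ≤ Real.log N := by
  have h2 := log_pow_mul_prod_sq (s := s) (A := M / (2 * n + 1 : ℕ) / ε) (by positivity) n
  rw [Real.log_div (by positivity) hε.ne', Real.log_div hM.ne' (by positivity),
    ← neg_neg (Real.log ε), ← Real.log_inv, sub_neg_eq_add] at h2
  have h3 : Real.log (((2 * n + 1 : ℕ) : ℝ) ^ (2 * n + 1) * ∏ k : ZMod (2 * n + 1),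
      (M / (2 * n + 1 : ℕ) / ε * Real.exp (-s * |(k.valMinAbs : ℝ)|)) ^ 2) ≤ Real.log N := by
    refine Real.log_le_log (by positivity) (le_of_eq_of_le ?_ h)
    congr 1
    refine Finset.prod_congr rfl fun k _ => ?_
    congr 1
    ring
  rw [h2] at h3
  linarith

/-- Up to degree n every e^{-s|k|} is at least ε/K, so the summand 1 is absorbed into a constant
multiple of (4 + ln m) e^{-s|k|}/ε, and the product becomes explicit. -/
theorem log_le_of_volume_bound {s M K ε N : ℝ} (hs : 0 < s) (hM : 0 < M) (hK : 0 < K) (hε : 0 < ε)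
    (hN : 0 < N) {n : ℕ} (hn : ε ≤ K * Real.exp (-s * n))
    (h : N ≤ ((2 * n + 1 : ℕ) : ℝ) ^ (2 * n + 1) * ∏ k : ZMod (2 * n + 1),
        (1 + 2 * (M * Real.exp (-s * |(k.valMinAbs : ℝ)|)) /
          (ε / (2 * (4 + Real.log (2 * n + 1 : ℕ))))) ^ 2) :
    Real.log N ≤ (2 * n + 1 : ℕ) * Real.log (2 * n + 1 : ℕ) + 2 * (2 * n + 1 : ℕ) *
      (Real.log (K + 4 * M) + Real.log (4 + Real.log (2 * n + 1 : ℕ)) + Real.log ε⁻¹)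
        - 2 * s * (n * (n + 1)) := by
  have hlog : 0 ≤ Real.log (2 * n + 1 : ℕ) := Real.log_natCast_nonneg _
  obtain ⟨Λ, hΛ⟩ : ∃ Λ, Λ = 4 + Real.log (2 * n + 1 : ℕ) := ⟨_, rfl⟩
  have hΛ4 : 4 ≤ Λ := by linarith
  rw [← hΛ] at h ⊢
  have h2 := log_pow_mul_prod_sq (s := s) (A := (K + 4 * M) * Λ / ε) (by positivity) n
  rw [Real.log_div (by positivity) hε.ne', Real.log_mul (x := K + 4 * M) (y := Λ) (by positivity) (by positivity),
    ← neg_neg (Real.log ε), ← Real.log_inv, sub_neg_eq_add] at h2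
  rw [← h2]
  refine Real.log_le_log hN (h.trans ?_)
  refine mul_le_mul_of_nonneg_left (Finset.prod_le_prod (fun k _ => by positivity) fun k _ => ?_)
    (by positivity)
  refine pow_le_pow_left₀ (by positivity) ?_ 2
  have h4 : Real.exp (-s * n) ≤ Real.exp (-s * |(k.valMinAbs : ℝ)|) := by
    apply Real.exp_le_exp.2
    have := mul_le_mul_of_nonneg_left (abs_valMinAbs_le n k) hs.le
    linarith
  have h5 : ε ≤ K * Real.exp (-s * |(k.valMinAbs : ℝ)|) :=
    hn.trans (mul_le_mul_of_nonneg_left h4 hK.le)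
  have h6 : ε ≤ Λ * (K * Real.exp (-s * |(k.valMinAbs : ℝ)|)) :=
    h5.trans (le_mul_of_one_le_left (by positivity) (by linarith))
  rw [div_div_eq_mul_div, div_mul_eq_mul_div, ← div_self hε.ne', ← add_div]
  refine div_le_div_of_nonneg_right ?_ hε.le
  linarith

/-- Comparison of the estimates at the cutoff with their asymptotic form. -/
theorem abs_sub_le_of_cutoff {s ℓ θ b n m h P Q : ℝ} (hs : 0 < s)
    (hθ : n = ℓ / s + θ) (hθb : |θ| ≤ b) (hm : m = 2 * n + 1) (hm1 : 1 ≤ m)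
    (hlow : 2 * m * (Q + ℓ) - m * Real.log m - 2 * s * (n * (n + 1)) ≤ h)
    (hhigh : h ≤ m * Real.log m + 2 * m * (P + Real.log (4 + Real.log m) + ℓ)
      - 2 * s * (n * (n + 1))) :
    |h - 2 / s * ℓ ^ 2| ≤ (2 / s * ℓ + (2 * b + 1)) * Real.log (2 / s * ℓ + (2 * b + 1)) +
      2 * (2 / s * ℓ + (2 * b + 1)) * (|P| + |Q| +
        Real.log (4 + Real.log (2 / s * ℓ + (2 * b + 1)))) + 2 * s * (b ^ 2 + b) := by
  have hlogm : 0 ≤ Real.log m := Real.log_nonneg hm1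
  have hΛ1 : 0 ≤ Real.log (4 + Real.log m) := Real.log_nonneg (by linarith)
  -- The choice n ≈ ℓ/s cancels the ℓθ terms, so rounding costs only O(1).
  have hmain : 2 * m * ℓ - 2 * s * (n * (n + 1)) = 2 / s * ℓ ^ 2 - 2 * s * (θ ^ 2 + θ) := by
    rw [hm, hθ]
    field_simp
    ring
  have herr : |2 * s * (θ ^ 2 + θ)| ≤ 2 * s * (b ^ 2 + b) := by
    rw [abs_mul, abs_of_pos (by positivity : 0 < 2 * s)]
    refine mul_le_mul_of_nonneg_left ?_ (by positivity)
    refine (abs_add_le _ _).trans (add_le_add ?_ hθb)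
    rw [abs_pow]
    exact pow_le_pow_left₀ (abs_nonneg _) hθb 2
  have hmW : m ≤ 2 / s * ℓ + (2 * b + 1) := by
    have : m = 2 / s * ℓ + (2 * θ + 1) := by
      rw [hm, hθ]; ring
    rw [this]
    linarith [le_abs_self θ]
  obtain ⟨W, hW⟩ : ∃ W, W = 2 / s * ℓ + (2 * b + 1) := ⟨_, rfl⟩
  rw [← hW] at hmW ⊢
  have hlm : Real.log m ≤ Real.log W := Real.log_le_log (by linarith) hmW
  have hlΛ : Real.log (4 + Real.log m) ≤ Real.log (4 + Real.log W) :=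
    Real.log_le_log (by linarith) (by linarith)
  have hmono1 : m * Real.log m ≤ W * Real.log W :=
    mul_le_mul hmW hlm hlogm (by linarith)
  have hmono2 : m * (|P| + |Q| + Real.log (4 + Real.log m)) ≤
      W * (|P| + |Q| + Real.log (4 + Real.log W)) :=
    mul_le_mul hmW (by linarith) (by positivity) (by linarith)
  have herr' := abs_le.1 herr
  have hm0 : 0 ≤ m := by linarith
  have t1 : m * P ≤ m * |P| := mul_le_mul_of_nonneg_left (le_abs_self _) hm0
  have t2 : m * (-|Q|) ≤ m * Q := mul_le_mul_of_nonneg_left (neg_abs_le _) hm0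
  have t3 : 0 ≤ m * |Q| := by positivity
  have t4 : 0 ≤ m * |P| := by positivity
  have t5 : 0 ≤ m * Real.log (4 + Real.log m) := by positivity
  rw [abs_le]
  constructor <;> linarith

/-- Two-sided estimate of the natural logarithm of the covering number. -/
theorem exists_abs_log_externalCoveringNumber_sub_le {s M : ℝ} (hs : 0 < s) (hM : 0 < M)
    {X : Set PeriodicFun} (hX : analyticStripClass s M ⊆ X) :
    ∃ B C E : ℝ, ∀ᶠ ε in 𝓝[>] (0 : ℝ),
      |Real.log ((Metric.externalCoveringNumber ε.toNNReal
        ((↑) ⁻¹' analyticStripClass s M : Set X)).toNat : ℝ) - 2 / s * Real.log ε⁻¹ ^ 2| ≤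
      (2 / s * Real.log ε⁻¹ + B) * Real.log (2 / s * Real.log ε⁻¹ + B) +
        2 * (2 / s * Real.log ε⁻¹ + B) *
          (E + Real.log (4 + Real.log (2 / s * Real.log ε⁻¹ + B))) + C := by
  have h1 : 0 < 1 - Real.exp (-s) := by simpa using hs
  obtain ⟨K, hK'⟩ : ∃ K, K = 8 * M * (1 - Real.exp (-s))⁻¹ := ⟨_, rfl⟩
  have hK : 0 < K := by rw [hK']; positivity
  -- Bounds the distance from n to ℓ/s; the 1 pays for the ceiling.
  obtain ⟨b, hb⟩ : ∃ b, b = |Real.log K| / s + 1 := ⟨_, rfl⟩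
  refine ⟨2 * b + 1, 2 * s * (b ^ 2 + b),
    |Real.log (K * Real.exp s + 4 * M)| + |Real.log M|, ?_⟩
  have hlim : Tendsto (fun ε : ℝ => Real.log ε⁻¹) (𝓝[>] 0) atTop :=
    Real.tendsto_log_atTop.comp tendsto_inv_nhdsGT_zero
  filter_upwards [hlim.eventually_ge_atTop (|Real.log K|), self_mem_nhdsWithin] with ε hε1 hε
  have hε : 0 < ε := hε
  obtain ⟨n, hn⟩ : ∃ n, n = cutoff s K ε := ⟨_, rfl⟩
  have hup := externalCoveringNumber_le_cutoff hs hM hX hε (hK' ▸ hn)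
  have hlow := le_externalCoveringNumber hM hX hε n
    (ne_top_of_le_ne_top (ENat.natCast_ne_top _) hup)
  have h2 := ENat.toNat_le_toNat hup (ENat.natCast_ne_top _)
  rw [ENat.toNat_natCast] at h2
  have hup' := (Nat.le_floor_iff (by positivity)).1 h2
  have hsum0 : 0 ≤ Real.log ε⁻¹ + Real.log K := by linarith [neg_abs_le (Real.log K)]
  have hcut := le_exp_cutoff hs hK hε hsum0
  rw [← hn] at hcut
  have hNpos := lt_of_lt_of_le (by positivity) hlow
  have hLow := le_log_of_volume_bound hM hε hlow
  have hHigh := log_le_of_volume_bound hs hM (by positivity) hε hNpos hcut hup'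
  refine abs_sub_le_of_cutoff (θ := n - Real.log ε⁻¹ / s) hs (by ring) ?_ (by push_cast; rfl)
    (by exact_mod_cast Nat.succ_le_succ (Nat.zero_le _)) hLow hHigh
  have e1 := Nat.le_ceil ((Real.log ε⁻¹ + Real.log K) / s)
  have e2 := Nat.ceil_lt_add_one (div_nonneg hsum0 hs.le)
  have e3 : (⌈(Real.log ε⁻¹ + Real.log K) / s⌉₊ : ℝ) = n := by rw [hn, cutoff]
  rw [e3, add_div] at e1 e2
  have e4 : |Real.log K / s| = |Real.log K| / s := by rw [abs_div, abs_of_pos hs]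
  have e5 := le_abs_self (Real.log K / s)
  have e6 := neg_abs_le (Real.log K / s)
  rw [e4] at e5 e6
  rw [abs_le, hb]
  constructor <;> linarith

/-! ### Asymptotics of the error term. -/

theorem tendsto_linear_div {a B : ℝ} (ha : 0 < a) :
    Tendsto (fun t : ℝ => (a * t + B) / (a * t)) atTop (𝓝 1) := by
  have h : Tendsto (fun t : ℝ => 1 + B / (a * t)) atTop (𝓝 (1 + 0)) :=
    tendsto_const_nhds.add (tendsto_const_nhds.div_atTop (tendsto_id.const_mul_atTop ha))
  rw [add_zero] at h
  refine h.congr' ?_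
  filter_upwards [eventually_gt_atTop 0] with t ht
  field_simp

/-- Numerator and denominator differ by a convergent quantity, and the denominator is unbounded.
Later κ = ln 2 accounts for the change of base. -/
theorem tendsto_log_linear_div_log {a B κ : ℝ} (ha : 0 < a) (hκ : 0 < κ) :
    Tendsto (fun t : ℝ => Real.log (a * t + B) / Real.log (t / κ)) atTop (𝓝 1) := by
  have hden : Tendsto (fun t : ℝ => Real.log (t / κ)) atTop atTop :=
    Real.tendsto_log_atTop.comp (tendsto_id.atTop_div_const hκ)
  have h1 : Tendsto (fun t : ℝ => Real.log ((a * t + B) / (a * t)) + Real.log (a * κ)) atTop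
      (𝓝 (Real.log 1 + Real.log (a * κ))) :=
    ((Real.continuousAt_log one_ne_zero).tendsto.comp (tendsto_linear_div ha)).add_const _
  have h2 : Tendsto (fun t : ℝ => 1 + (Real.log ((a * t + B) / (a * t)) + Real.log (a * κ)) /
      Real.log (t / κ)) atTop (𝓝 (1 + 0)) := tendsto_const_nhds.add (h1.div_atTop hden)
  rw [add_zero] at h2
  refine h2.congr' ?_
  have hnum : Tendsto (fun t : ℝ => a * t + B) atTop atTop :=
    tendsto_atTop_add_const_right _ _ (tendsto_id.const_mul_atTop ha)
  filter_upwards [eventually_gt_atTop 0, hden.eventually_gt_atTop 0, hnum.eventually_gt_atTop 0]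
    with t ht hl hn
  rw [Real.log_div hn.ne' (by positivity), Real.log_mul ha.ne' ht.ne', Real.log_mul ha.ne' hκ.ne']
  have : Real.log (t / κ) = Real.log t - Real.log κ := Real.log_div ht.ne' hκ.ne'
  rw [eq_div_iff hl.ne', add_mul, div_mul_cancel₀ _ hl.ne', this]
  ring

theorem tendsto_log_add_div_self (c : ℝ) :
    Tendsto (fun u : ℝ => Real.log (c + u) / u) atTop (𝓝 0) := by
  have h1 : Tendsto (fun u : ℝ => Real.log (c + u) / (c + u)) atTop (𝓝 0) := by
    have := Real.isLittleO_log_id_atTop.tendsto_div_nhds_zero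
    exact this.comp (tendsto_atTop_add_const_left _ c tendsto_id)
  have h2 := h1.mul (tendsto_linear_div (B := c) one_pos)
  rw [zero_mul] at h2
  refine h2.congr' ?_
  filter_upwards [eventually_gt_atTop 0, eventually_gt_atTop (-c)] with u hu hc
  have : c + u ≠ 0 := by linarith
  rw [one_mul, add_comm u c, div_mul_div_cancel₀ this]

/-- The error term of the covering number estimate is asymptotic to `a t log (t / κ)`. -/
theorem tendsto_error_div {a κ : ℝ} (ha : 0 < a) (hκ : 0 < κ) (B C E : ℝ) :
    Tendsto (fun t : ℝ => ((a * t + B) * Real.log (a * t + B) +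
      2 * (a * t + B) * (E + Real.log (4 + Real.log (a * t + B))) + C) /
        (a * t * Real.log (t / κ))) atTop (𝓝 1) := by
  have hden : Tendsto (fun t : ℝ => Real.log (t / κ)) atTop atTop :=
    Real.tendsto_log_atTop.comp (tendsto_id.atTop_div_const hκ)
  have hat : Tendsto (fun t : ℝ => a * t) atTop atTop := tendsto_id.const_mul_atTop ha
  have hlogW : Tendsto (fun t : ℝ => Real.log (a * t + B)) atTop atTop :=
    Real.tendsto_log_atTop.comp (tendsto_atTop_add_const_right _ _ hat)
  have h1 := tendsto_linear_div (B := B) ha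
  have h2 := tendsto_log_linear_div_log (B := B) ha hκ
  have h3 := (tendsto_log_add_div_self 4).comp hlogW
  have h4 : Tendsto (fun t : ℝ => E / Real.log (t / κ)) atTop (𝓝 0) :=
    tendsto_const_nhds.div_atTop hden
  have h5 : Tendsto (fun t : ℝ => C / (a * t * Real.log (t / κ))) atTop (𝓝 0) :=
    tendsto_const_nhds.div_atTop (hat.atTop_mul_atTop₀ hden)
  have h := (h1.mul (h2.add ((h4.add (h3.mul h2)).const_mul 2))).add h5
  simp only [mul_one, add_zero, mul_zero] at h
  refine h.congr' ?_
  filter_upwards [eventually_gt_atTop 0, hden.eventually_gt_atTop 0, hlogW.eventually_gt_atTop 0]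
    with t ht hl hw
  simp only [Function.comp_apply]
  field_simp

/-- Splits a quantity with limsup of modulus at most 1 into a part bounded by 1 and a remainder
tending to 0. -/
theorem abs_sub_clamp_le {x q : ℝ} (h : |x| ≤ q) : |x - max (-1) (min 1 x)| ≤ max (q - 1) 0 := by
  have := abs_le.1 h
  rcases le_total 1 x with h1 | h1
  · rw [min_eq_left h1, max_eq_right (by norm_num), abs_of_nonneg (by linarith)]
    exact le_max_of_le_left (by linarith)
  · rw [min_eq_right h1]
    rcases le_total (-1) x with h2 | h2
    · rw [max_eq_right h2]; simp
    · rw [max_eq_left h2, abs_of_nonpos (by linarith)]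
      exact le_max_of_le_left (by linarith)

theorem mainTheorem5 (s M : ℝ) (hs : 0 < s) (hM : 0 < M)
    (X : Set PeriodicFun) (hX : analyticStripClass s M ⊆ X) :
    (∀ ε : ℝ, 0 < ε →
      Metric.externalCoveringNumber ε.toNNReal
        ((↑) ⁻¹' analyticStripClass s M : Set X) ≠ ⊤) ∧
    ∃ γ o : ℝ → ℝ,
      (∀ ε : ℝ, 0 < ε → |γ ε| ≤ 1) ∧
      Tendsto o (𝓝[>] 0) (𝓝 0) ∧
      ∀ᶠ ε in 𝓝[>] (0 : ℝ),
        metricEntropy ((↑) ⁻¹' analyticStripClass s M : Set X) ε =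
          2 * Real.log 2 / s *
            (Real.logb 2 ε⁻¹ ^ 2 +
              Real.logb 2 ε⁻¹ * Real.logb 2 (Real.logb 2 ε⁻¹) * (γ ε + o ε)) := by
  refine ⟨fun ε hε => ne_top_of_le_ne_top (ENat.natCast_ne_top _)
    (externalCoveringNumber_le_cutoff hs hM hX hε rfl), ?_⟩
  obtain ⟨B, C, E, hest⟩ := exists_abs_log_externalCoveringNumber_sub_le hs hM hX
  have hln2 : 0 < Real.log 2 := Real.log_pos one_lt_two
  have hlim : Tendsto (fun ε : ℝ => Real.log ε⁻¹) (𝓝[>] 0) atTop :=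
    Real.tendsto_log_atTop.comp tendsto_inv_nhdsGT_zero
  have hden : Tendsto (fun t : ℝ => Real.log (t / Real.log 2)) atTop atTop :=
    Real.tendsto_log_atTop.comp (tendsto_id.atTop_div_const hln2)
  let h : ℝ → ℝ := fun ε => Real.log ((Metric.externalCoveringNumber ε.toNNReal
    ((↑) ⁻¹' analyticStripClass s M : Set X)).toNat : ℝ)
  -- The normalised error: ℓ/ln 2 is the base 2 logarithm of 1/ε. Clamping x to [-1, 1] gives γ, and
  -- the excess is o.
  let x : ℝ → ℝ := fun ε => (h ε - 2 / s * Real.log ε⁻¹ ^ 2) /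
    (2 / s * Real.log ε⁻¹ * Real.log (Real.log ε⁻¹ / Real.log 2))
  refine ⟨fun ε => max (-1) (min 1 (x ε)), fun ε => x ε - max (-1) (min 1 (x ε)), ?_, ?_, ?_⟩
  · intro ε _
    exact abs_le.2 ⟨le_max_left _ _, max_le (by norm_num) (min_le_left _ _)⟩
  · have hq := (tendsto_error_div (div_pos two_pos hs) hln2 B C E).comp hlim
    have hq' := (hq.sub_const 1).max (tendsto_const_nhds (x := (0 : ℝ)))
    rw [sub_self, max_self] at hq'
    refine squeeze_zero_norm' ?_ hq'
    filter_upwards [hest, hlim.eventually_gt_atTop 0, hlim.eventually (hden.eventually_gt_atTop 0)]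
      with ε h1 h2 h3
    refine abs_sub_clamp_le ?_
    have hpos : 0 < 2 / s * Real.log ε⁻¹ * Real.log (Real.log ε⁻¹ / Real.log 2) := by positivity
    rw [abs_div, abs_of_pos hpos]
    exact div_le_div_of_nonneg_right h1 hpos.le
  · filter_upwards [hlim.eventually_gt_atTop 0, hlim.eventually (hden.eventually_gt_atTop 0)]
      with ε h2 h3
    rw [add_sub_cancel]
    simp only [metricEntropy, Real.logb]
    have hx : h ε = 2 / s * Real.log ε⁻¹ ^ 2 +
        2 / s * Real.log ε⁻¹ * Real.log (Real.log ε⁻¹ / Real.log 2) * x ε := by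
      simp only [x]
      rw [mul_div_cancel₀ _ (by positivity)]
      ring
    change h ε / Real.log 2 = _
    rw [hx]
    field_simp
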